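/- Let $\mathbb N=\{1,2,3,\dots\}$, let $\wp_{fin}(X)$ be the set of finite subsets of $X$, and let $\beta\mathbb N$ be the set of ultrafilters on $\mathbb N$. Let $\mathbb P$ be the set of polynomials with integer coefficients that vanish at $0$ and map $\mathbb N$ into $\mathbb N$. An IP-set is a family $(x_\alpha)_{\alpha\in\wp_{fin}(\mathbb N)\setminus\{\emptyset\}}$ of the form $x_\alpha=\sum_{t\in\alpha}s_t$ for some sequence $(s_t)_{t\in\mathbb N}$ in $\mathbb N$; let $\mathcal{IP}$ be the set of all IP-sets. A set $A\subseteq\mathbb N$ is a $J_p$-set if for all finite $F\subset\mathbb P$, all $l\in\mathbb N$ and all IP-sets $(x^i_\alpha)_\alpha$, $i=1,\dots,l$, there are $a\in\mathbb N\cup\{0\}$ and $\beta\in\wp_{fin}(\mathbb N)\setminus\{\emptyset\}$ such that $a+P(x^i_\beta)\in A$ for all $P\in F$ and $i\in\{1,\dots,l\}$. Let $\mathcal J_p$ be the set of those ultrafilters in $\beta\mathbb N$ all of whose members are $J_p$-sets (here the index $p$ is only part of the name). Fix a nonstandard extension $X\mapsto{}^{\ast}X$ that satisfies the transfer principle and is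 $|\wp(\mathbb N)|^+$-saturated, i.e. every family of at most $|\wp(\mathbb N)|$ internal subsets of some ${}^{\ast}X$ that has the finite intersection property has nonempty intersection. Identify each standard object $x\in X$ with its image ${}^{\ast}x\in{}^{\ast}X$. For $p\in\beta\mathbb N$ let $\mu(p)=\{\xi\in{}^{\ast}\mathbb N\mid \xi\in{}^{\ast}A\text{ for all }A\in p\}$ be its monad. **Proposition.** Let $p\in\beta\mathbb N$. The following are equivalent: 1. $p\in\mathcal J_p$; 2. there exist $\eta\in{}^{\ast}\mathbb N$ and $\beta\in{}^{\ast}(\wp_{fin}(\mathbb N)\setminus\{\emptyset\})$ such that for all (standard) IP-sets $(x_\alpha)_\alpha$ and all $P\in\mathbb P$, $\eta+P(x_\beta)\in\mu(p)$, where $P(x_\beta)$ is computed with the extensions of $P$ and $(x_\alpha)_\alpha$; 3. there exist $\eta\in{}^{\ast}\mathbb N$, $\beta\in{}^{\ast}(\wp_{fin}(\mathbb N)\setminus\{\emptyset\})$ and hyperfinite sets $I\in{}^{\ast}\wp_{fin}(\mathcal{IP})$, $H\in{}^{\ast}\wp_{fin}(\mathbb P)$ such that $\mathcal{IP}\subseteq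 I$, $\mathbb P\subseteq H$ and, for all $(x_\alpha)_\alpha\in I$ and all $P\in H$, $\eta+P(x_\beta)\in\mu(p)$. -/

import Mathlib

universe u

/-! Throughout, the set of natural numbers is `{1, 2, 3, …}`, i.e. the type `ℕ+`. -/

/-- Nonempty finite sets of natural numbers. -/
abbrev NEFin : Type := {α : Finset ℕ+ // α.Nonempty}

/-- IP-sets, as indexed families `(x_α)`, `α` ranging over the nonempty finite sets of natural
numbers: families of the form `x_α = ∑_{t ∈ α} s_t` for a sequence `s` of natural numbers. -/
def IPSet : Type := {x : NEFin → ℕ+ // ∃ s : ℕ+ → ℕ+, ∀ α, (x α : ℕ) = ∑ t ∈ α.1, (s t : ℕ)}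

/-- The member `x_α` of an IP-set. -/
def IPSet.at (x : IPSet) (α : NEFin) : ℕ+ := x.1 α

/-- Polynomials with integer coefficients that vanish at `0` and map the (positive) natural
numbers into the (positive) natural numbers. -/
def PolyN : Type := {P : Polynomial ℤ // P.eval 0 = 0 ∧ ∀ n : ℕ+, 0 < P.eval ((n : ℕ) : ℤ)}

/-- The value `P(n)`. -/
def PolyN.app (P : PolyN) (n : ℕ+) : ℕ+ :=
  ⟨(P.1.eval ((n : ℕ) : ℤ)).toNat, Int.lt_toNat.mpr (P.2.2 n)⟩

theorem PolyN.coe_app (P : PolyN) (n : ℕ+) : ((P.app n : ℕ) : ℤ) = P.1.eval ((n : ℕ) : ℤ) :=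
  Int.toNat_of_nonneg (P.2.2 n).le

/-- `J_p`-sets: for every finite set `F` of polynomials and any finitely many IP-sets
`x^1, …, x^l` there are `a ∈ {0, 1, 2, …}` and `β` with `a + P(x^i_β) ∈ A` for all `P ∈ F` and
all `i`. -/
def IsJpSet (A : Set ℕ+) : Prop :=
  ∀ (F : Finset PolyN) (l : ℕ) (x : Fin l → IPSet),
    ∃ (a : ℕ) (β : NEFin), ∀ P ∈ F, ∀ i, ∃ n ∈ A, (n : ℕ) = a + P.app ((x i).at β)

/-- The set of the ultrafilters on the natural numbers all of whose members are `J_p`-sets. -/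
def JpUltrafilters : Set (Ultrafilter ℕ+) := {p | ∀ A ∈ p, IsJpSet A}

/-- A nonstandard extension. To every set (type) `X` it attaches `*X`, to every `f : X → Y` a map
`*f : *X → *Y`, to every `A ⊆ X` a set `*A ⊆ *X`, and to every `x ∈ X` the element `*x ∈ *X`;
the ordered pair of `ξ ∈ *X` and `υ ∈ *Y` is an element of `*(X × Y)`.
The laws are the transfer principle for first-order formulas over the standard universe,
given through its clauses for terms, constants, atomic formulas, equality, `¬`, `∧` and `∃`
(`∃` is the image under a coordinate projection). Relations are subsets of products, and
quantification over subsets of `X` is quantification over `*(Set X)`, i.e. over the internal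
subsets of `*X`. -/
structure NonstandardExtension where
  /-- `*X` -/
  Star : Type → Type u
  /-- `*f` -/
  map : ∀ {X Y : Type}, (X → Y) → Star X → Star Y
  /-- `*A` -/
  ext : ∀ {X : Type}, Set X → Set (Star X)
  /-- `*x` -/
  of : ∀ {X : Type}, X → Star X
  /-- `(ξ, υ)` -/
  pair : ∀ {X Y : Type}, Star X → Star Y → Star (X × Y)
  map_id : ∀ {X : Type} (ξ : Star X), map (fun x : X => x) ξ = ξ
  map_comp : ∀ {X Y Z : Type} (g : Y → Z) (f : X → Y) (ξ : Star X),
    map (fun x => g (f x)) ξ = map g (map f ξ)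
  map_of : ∀ {X Y : Type} (f : X → Y) (x : X), map f (of x) = of (f x)
  of_mem_ext : ∀ {X : Type} (A : Set X) (x : X), of x ∈ ext A ↔ x ∈ A
  map_fst_pair : ∀ {X Y : Type} (ξ : Star X) (υ : Star Y), map Prod.fst (pair ξ υ) = ξ
  map_snd_pair : ∀ {X Y : Type} (ξ : Star X) (υ : Star Y), map Prod.snd (pair ξ υ) = υ
  pair_map : ∀ {X Y : Type} (ζ : Star (X × Y)), pair (map Prod.fst ζ) (map Prod.snd ζ) = ζ
  pair_mem_ext_diagonal : ∀ {X : Type} (ξ υ : Star X),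
    pair ξ υ ∈ ext {z : X × X | z.1 = z.2} ↔ ξ = υ
  ext_compl : ∀ {X : Type} (A : Set X), ext Aᶜ = (ext A)ᶜ
  ext_inter : ∀ {X : Type} (A B : Set X), ext (A ∩ B) = ext A ∩ ext B
  ext_preimage : ∀ {X Y : Type} (f : X → Y) (B : Set Y), ext (f ⁻¹' B) = map f ⁻¹' ext B
  ext_image : ∀ {X Y : Type} (f : X → Y) (A : Set X), ext (f '' A) = map f '' ext A

namespace NonstandardExtension

variable (N : NonstandardExtension.{u})

/-- The nonstandard extension of a binary operation. -/
def map₂ {X Y Z : Type} (f : X → Y → Z) (ξ : N.Star X) (υ : N.Star Y) : N.Star Z :=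
  N.map (fun z : X × Y => f z.1 z.2) (N.pair ξ υ)

/-- The internal subset of `*X` that an element of `*(Set X)` stands for. -/
def internal {X : Type} (B : N.Star (Set X)) : Set (N.Star X) :=
  {ξ | N.pair ξ B ∈ N.ext {z : X × Set X | z.1 ∈ z.2}}

/-- The hyperfinite subset of `*X` that an element of `*(Finset X)` stands for. -/
def hyperfinite {X : Type} (I : N.Star (Finset X)) : Set (N.Star X) :=
  {ξ | N.pair ξ I ∈ N.ext {z : X × Finset X | z.1 ∈ z.2}}

/-- `κ`-saturation: every family of fewer than `κ` internal subsets of some `*X` that has the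
finite intersection property has a common point. -/
def IsSaturated (κ : Cardinal.{u}) : Prop :=
  ∀ (X : Type) (S : Set (Set (N.Star X))),
    (∀ s ∈ S, ∃ B : N.Star (Set X), s = N.internal B) →
    Cardinal.mk S < κ →
    (∀ T ⊆ S, T.Finite → (⋂₀ T).Nonempty) →
    (⋂₀ S).Nonempty

/-- The monad `μ(p)` of an ultrafilter on the natural numbers. -/
def monad (p : Ultrafilter ℕ+) : Set (N.Star ℕ+) := {ξ | ∀ A ∈ p, ξ ∈ N.ext A}

/-- `η + P(x_β)` in `*ℕ`, for `η ∈ *ℕ`, an internal polynomial `P`, an internal IP-set `x` and an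
internal nonempty hyperfinite set `β`. -/
def shiftedValue (η : N.Star ℕ+) (P : N.Star PolyN) (x : N.Star IPSet) (β : N.Star NEFin) :
    N.Star ℕ+ :=
  N.map₂ (fun a b : ℕ+ => a + b) η (N.map₂ PolyN.app P (N.map₂ IPSet.at x β))

end NonstandardExtension

/-!
The standard part of the argument is that an ultrafilter `p` of `J_p`-sets satisfies the defining
condition of `J_p`-sets with a *positive* shift `a` (`exists_pos_shift`), which is what an element
`η` of `*ℕ` with `ℕ = {1, 2, 3, …}` requires. To force `a ≠ 0`, intersect the given member of `p`
with whichever of the two classes `{n | v₂ n even}`, `{n | v₂ n odd}` belongs to `p`, and add the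
polynomials `n` and `2n` to the given ones: with `a = 0` the values `x_β` and `2 x_β` would lie in
the same class, although their 2-adic valuations differ by one.

Given this, `1 → 3` is one application of saturation to the sets of quadruples `(a, β, I, H)`
such that `a + P(x_β) ∈ A` for all `x ∈ I`, `P ∈ H`, and such that `I`, `H` contain a prescribed
IP-set and a prescribed polynomial; there are at most continuum many such conditions, and finitely
many of them are met by a standard quadruple. `3 → 2` is immediate, and `2 → 1` is transfer:
a standard set whose extension is nonempty is nonempty.
-/

/-! ### Transfer -/

namespace NonstandardExtension

variable (N : NonstandardExtension.{u})

theorem ext_empty {X : Type} : N.ext (∅ : Set X) = ∅ := by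
  rw [← Set.inter_compl_self (∅ : Set X), ext_inter, ext_compl, Set.inter_compl_self]

theorem ext_univ {X : Type} : N.ext (Set.univ : Set X) = Set.univ := by
  rw [← Set.compl_empty, ext_compl, ext_empty, Set.compl_empty]

theorem mem_ext_inter {X : Type} {A B : Set X} {ξ : N.Star X} (hA : ξ ∈ N.ext A)
    (hB : ξ ∈ N.ext B) : ξ ∈ N.ext (A ∩ B) := by
  rw [ext_inter]
  exact ⟨hA, hB⟩

theorem ext_mono {X : Type} {A B : Set X} (h : A ⊆ B) : N.ext A ⊆ N.ext B := by
  rw [← Set.inter_eq_left.2 h, ext_inter]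
  exact Set.inter_subset_right

theorem nonempty_of_mem_ext {X : Type} {A : Set X} {ξ : N.Star X} (h : ξ ∈ N.ext A) :
    A.Nonempty := by
  rw [Set.nonempty_iff_ne_empty]
  rintro rfl
  rw [ext_empty] at h
  exact h

theorem mem_ext_setOf_forall_mem_finset {X κ : Type} (s : Finset κ) (A : κ → Set X) (ξ : N.Star X)
    (h : ∀ k ∈ s, ξ ∈ N.ext (A k)) : ξ ∈ N.ext {x | ∀ k ∈ s, x ∈ A k} := by
  classical
  induction s using Finset.induction_on with
  | empty => simp [ext_univ]
  | insert k s _ ih =>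
    have h' : {x | ∀ j ∈ insert k s, x ∈ A j} = A k ∩ {x | ∀ j ∈ s, x ∈ A j} := by
      ext x; simp
    rw [h']
    exact N.mem_ext_inter (h k (Finset.mem_insert_self k s))
      (ih fun j hj => h j (Finset.mem_insert_of_mem hj))

theorem subsingleton_star_unit (ξ υ : N.Star Unit) : ξ = υ := by
  rw [← N.pair_mem_ext_diagonal, show {z : Unit × Unit | z.1 = z.2} = Set.univ from
    Set.eq_univ_of_forall fun _ => rfl, ext_univ]
  trivial

/-- The extension of a constant map is constant, since it factors through `*Unit`, which is a
single point. -/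
theorem map_const {X Y : Type} (c : Y) (ξ : N.Star X) : N.map (fun _ : X => c) ξ = N.of c := by
  rw [N.map_comp (fun _ : Unit => c) (fun _ : X => ()) ξ,
    N.subsingleton_star_unit (N.map _ ξ) (N.of ()), map_of]

theorem pair_map_map {X Y Z : Type} (f : X → Y) (g : X → Z) (ξ : N.Star X) :
    N.pair (N.map f ξ) (N.map g ξ) = N.map (fun x => (f x, g x)) ξ := by
  rw [← N.pair_map (N.map (fun x => (f x, g x)) ξ), ← N.map_comp, ← N.map_comp]

theorem map₂_map_map {X Y Z W : Type} (h : Y → Z → W) (f : X → Y) (g : X → Z) (ξ : N.Star X) :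
    N.map₂ h (N.map f ξ) (N.map g ξ) = N.map (fun x => h (f x) (g x)) ξ := by
  rw [map₂, pair_map_map, ← N.map_comp]

theorem mem_ext_preimage {X Y : Type} (f : X → Y) (B : Set Y) (ξ : N.Star X) :
    ξ ∈ N.ext (f ⁻¹' B) ↔ N.map f ξ ∈ N.ext B := by
  rw [ext_preimage, Set.mem_preimage]

theorem internal_of {X : Type} (C : Set X) : N.internal (N.of C) = N.ext C := by
  ext ξ
  have h : N.pair ξ (N.of C) = N.map (fun x => (x, C)) ξ := by
    rw [← N.map_const C ξ, ← N.pair_map_map (fun x => x) (fun _ => C), map_id]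
  rw [internal, Set.mem_ofPred_eq, h, ← mem_ext_preimage]
  rfl

theorem map_mem_hyperfinite_map {X Y : Type} (f : X → Y) (g : X → Finset Y) (ξ : N.Star X) :
    N.map f ξ ∈ N.hyperfinite (N.map g ξ) ↔ ξ ∈ N.ext {x | f x ∈ g x} := by
  rw [hyperfinite, Set.mem_ofPred_eq, pair_map_map, ← mem_ext_preimage]
  rfl

theorem of_mem_hyperfinite_map {X Y : Type} (y : Y) (g : X → Finset Y) (ξ : N.Star X) :
    N.of y ∈ N.hyperfinite (N.map g ξ) ↔ ξ ∈ N.ext {x | y ∈ g x} := by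
  rw [← N.map_const y ξ, map_mem_hyperfinite_map]

theorem shiftedValue_map {W : Type} (a : W → ℕ+) (P : W → PolyN) (x : W → IPSet) (β : W → NEFin)
    (ω : N.Star W) :
    N.shiftedValue (N.map a ω) (N.map P ω) (N.map x ω) (N.map β ω) =
      N.map (fun w => a w + (P w).app ((x w).at (β w))) ω := by
  simp only [shiftedValue, map₂_map_map]

/-- Saturation for families of extensions of standard sets, indexed by a type of cardinality less
than `κ`. -/
theorem IsSaturated.exists_forall_mem_ext {κ : Cardinal.{u}} (hN : N.IsSaturated κ) {ι X : Type}
    (hι : Cardinal.lift.{u} (Cardinal.mk ι) < κ) (U : ι → Set X)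
    (hU : ∀ t : Finset ι, ∃ x, ∀ i ∈ t, x ∈ U i) : ∃ ξ : N.Star X, ∀ i, ξ ∈ N.ext (U i) := by
  classical
  obtain ⟨ξ, hξ⟩ := hN X (Set.range fun i => N.ext (U i))
    (by
      rintro _ ⟨i, rfl⟩
      exact ⟨N.of (U i), (N.internal_of _).symm⟩)
    (by
      refine lt_of_le_of_lt ?_ hι
      simpa using Cardinal.mk_range_le_lift (f := fun i => N.ext (U i)))
    (by
      intro T hT hfin
      rw [← Set.image_univ] at hT
      lift T to Finset (Set (N.Star X)) using hfin
      obtain ⟨t, -, rfl⟩ := Finset.subset_set_image_iff.1 hT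
      obtain ⟨x, hx⟩ := hU t
      refine ⟨N.of x, fun s hs => ?_⟩
      obtain ⟨i, hi, rfl⟩ := Finset.mem_image.1 (Finset.mem_coe.1 hs)
      exact (N.of_mem_ext _ _).2 (hx i hi))
  exact ⟨ξ, fun i => hξ _ ⟨i, rfl⟩⟩

end NonstandardExtension

/-! ### Positive shifts -/

/-- The polynomial `k n`, for positive `k`. -/
noncomputable def PolyN.linear (k : ℕ+) : PolyN :=
  ⟨Polynomial.C ((k : ℕ) : ℤ) * Polynomial.X, by simp, fun n => by
    simp only [Polynomial.eval_mul, Polynomial.eval_C, Polynomial.eval_X]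
    exact_mod_cast Nat.mul_pos k.pos n.pos⟩

theorem PolyN.linear_app (k n : ℕ+) : (PolyN.linear k).app n = k * n := by
  have h := PolyN.coe_app (PolyN.linear k) n
  simp only [PolyN.linear, Polynomial.eval_mul, Polynomial.eval_C, Polynomial.eval_X] at h
  apply PNat.coe_injective
  rw [PNat.mul_coe]
  exact_mod_cast h

theorem even_padicValNat_two_mul_iff (n : ℕ+) :
    Even (padicValNat 2 (2 * n : ℕ)) ↔ ¬ Even (padicValNat 2 n) := by
  rw [padicValNat.mul two_ne_zero n.ne_zero, padicValNat_self, add_comm, Nat.even_add_one]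

instance : Nonempty IPSet :=
  ⟨⟨fun α => ⟨∑ t ∈ α.1, 1, by simpa using α.2⟩, fun _ => 1, fun _ => by simp⟩⟩

/-- Members of an ultrafilter of `J_p`-sets satisfy the condition for `J_p`-sets with a positive
shift. -/
theorem exists_pos_shift {p : Ultrafilter ℕ+} (hp : p ∈ JpUltrafilters) {A : Set ℕ+} (hA : A ∈ p)
    (F : Finset PolyN) (X : Finset IPSet) :
    ∃ (a : ℕ+) (β : NEFin), ∀ P ∈ F, ∀ x ∈ X, a + P.app (x.at β) ∈ A := by
  classical
  let E : Set ℕ+ := {n | Even (padicValNat 2 n)}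
  -- Some member of `p` below `A` contains no `n` together with `2n`.
  obtain ⟨B, hB, hBA, hdouble⟩ : ∃ B ∈ p, B ⊆ A ∧ ∀ n ∈ B, 2 * n ∉ B := by
    rcases p.mem_or_compl_mem E with hE | hE
    · refine ⟨A ∩ E, Filter.inter_mem hA hE, Set.inter_subset_left, fun n hn hn' => ?_⟩
      exact (even_padicValNat_two_mul_iff n).1 hn'.2 hn.2
    · refine ⟨A ∩ Eᶜ, Filter.inter_mem hA hE, Set.inter_subset_left, fun n hn hn' => ?_⟩
      exact hn'.2 ((even_padicValNat_two_mul_iff n).2 hn.2)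
  let x₀ : IPSet := Classical.arbitrary IPSet
  let Y : Finset IPSet := insert x₀ X
  obtain ⟨a, β, h⟩ := hp B hB (insert (PolyN.linear 1) (insert (PolyN.linear 2) F)) Y.card
    fun i => (Y.equivFin.symm i).1
  have h' : ∀ P ∈ insert (PolyN.linear 1) (insert (PolyN.linear 2) F), ∀ x ∈ Y,
      ∃ n ∈ B, (n : ℕ) = a + P.app (x.at β) := fun P hP x hx => by
    simpa using h P hP (Y.equivFin ⟨x, hx⟩)
  have ha : 0 < a := by
    rw [Nat.pos_iff_ne_zero]
    rintro rfl
    obtain ⟨m, hm, hm'⟩ := h' (PolyN.linear 1) (by simp) x₀ (Finset.mem_insert_self _ _)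
    obtain ⟨n, hn, hn'⟩ := h' (PolyN.linear 2) (by simp) x₀ (Finset.mem_insert_self _ _)
    rw [PolyN.linear_app, zero_add, PNat.coe_inj] at hm' hn'
    rw [one_mul] at hm'
    subst hm' hn'
    exact hdouble _ hm hn
  lift a to ℕ+ using ha
  refine ⟨a, β, fun P hP x hx => hBA ?_⟩
  obtain ⟨n, hn, hn'⟩ := h' P (by simp [hP]) x (Finset.mem_insert_of_mem hx)
  have hn'' : n = a + P.app (x.at β) := PNat.coe_injective (by rw [hn', PNat.add_coe])
  exact hn'' ▸ hn

/-! ### Cardinalities -/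

theorem mk_IPSet_le : Cardinal.mk IPSet ≤ Cardinal.continuum :=
  calc Cardinal.mk IPSet ≤ Cardinal.mk (NEFin → ℕ+) := Cardinal.mk_subtype_le _
    _ = Cardinal.aleph0 ^ Cardinal.mk NEFin := by simp
    _ ≤ Cardinal.aleph0 ^ Cardinal.aleph0 :=
      Cardinal.power_le_power_left Cardinal.aleph0_ne_zero Cardinal.mk_le_aleph0
    _ = Cardinal.continuum := by simp

theorem mk_PolyN_le : Cardinal.mk PolyN ≤ Cardinal.aleph0 :=
  (Cardinal.mk_subtype_le _).trans (Polynomial.cardinalMk_le_max.trans (by simp))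

/-- The conditions `A ∈ p`, `x ∈ I`, `P ∈ H` to be met simultaneously are at most continuum
many. -/
theorem mk_conditions_le (p : Ultrafilter ℕ+) :
    Cardinal.mk ({A : Set ℕ+ // A ∈ p} × IPSet × PolyN) ≤ Cardinal.mk (Set ℕ+) := by
  have hc : Cardinal.mk (Set ℕ+) = Cardinal.continuum := by simp
  rw [Cardinal.mk_prod, Cardinal.mk_prod, hc]
  simp only [Cardinal.lift_id]
  have h1 : Cardinal.mk {A : Set ℕ+ // A ∈ p} ≤ Cardinal.continuum :=
    hc ▸ Cardinal.mk_subtype_le _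
  have h2 : Cardinal.mk PolyN ≤ Cardinal.continuum :=
    mk_PolyN_le.trans Cardinal.aleph0_le_continuum
  calc _ ≤ Cardinal.continuum * (Cardinal.continuum * Cardinal.continuum) := by
        gcongr
        exact mk_IPSet_le
    _ = Cardinal.continuum := by simp

/-! ### The equivalence -/

namespace NonstandardExtension

variable (N : NonstandardExtension.{u})

theorem exists_hyperfinite_of_mem_JpUltrafilters
    (hN : N.IsSaturated (Order.succ (Cardinal.lift.{u} (Cardinal.mk (Set ℕ+)))))
    {p : Ultrafilter ℕ+} (hp : p ∈ JpUltrafilters) :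
    ∃ (η : N.Star ℕ+) (β : N.Star NEFin) (I : N.Star (Finset IPSet)) (H : N.Star (Finset PolyN)),
      (∀ x : IPSet, N.of x ∈ N.hyperfinite I) ∧ (∀ P : PolyN, N.of P ∈ N.hyperfinite H) ∧
      ∀ x ∈ N.hyperfinite I, ∀ P ∈ N.hyperfinite H, N.shiftedValue η P x β ∈ N.monad p := by
  classical
  let W : Type := ℕ+ × NEFin × Finset IPSet × Finset PolyN
  let D : Set ℕ+ → Set W := fun A =>
    {w | ∀ x ∈ w.2.2.1, ∀ P ∈ w.2.2.2, w.1 + P.app (x.at w.2.1) ∈ A}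
  obtain ⟨ω, hω⟩ := IsSaturated.exists_forall_mem_ext N hN
    (Order.lt_succ_iff.2 (Cardinal.lift_le.2 (mk_conditions_le p)))
    (fun c => D c.1 ∩ ({w | c.2.1 ∈ w.2.2.1} ∩ {w | c.2.2 ∈ w.2.2.2}))
    (by
      intro t
      have hA : (⋂ c ∈ t, c.1.1 : Set ℕ+) ∈ p :=
        (Filter.biInter_finset_mem t).2 fun c _ => c.1.2
      obtain ⟨a, β, h⟩ := exists_pos_shift hp hA (t.image fun c => c.2.2) (t.image fun c => c.2.1)
      refine ⟨(a, β, t.image fun c => c.2.1, t.image fun c => c.2.2), fun c hc => ⟨?_, ?_, ?_⟩⟩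
      · exact fun x hx P hP => Set.mem_iInter₂.1 (h P hP x hx) c hc
      · exact Finset.mem_image_of_mem (fun c => c.2.1) hc
      · exact Finset.mem_image_of_mem (fun c => c.2.2) hc)
  simp only [ext_inter] at hω
  refine ⟨N.map (fun w => w.1) ω, N.map (fun w => w.2.1) ω, N.map (fun w => w.2.2.1) ω,
    N.map (fun w => w.2.2.2) ω, fun x => ?_, fun P => ?_, fun x hx P hP A hA => ?_⟩
  · exact (N.of_mem_hyperfinite_map _ _ _).2
      (hω (⟨Set.univ, Filter.univ_mem⟩, x, PolyN.linear 1)).2.1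
  · exact (N.of_mem_hyperfinite_map _ _ _).2
      (hω (⟨Set.univ, Filter.univ_mem⟩, Classical.arbitrary IPSet, P)).2.2
  · have hD := (hω (⟨A, hA⟩, Classical.arbitrary IPSet, PolyN.linear 1)).1
    -- Everything is a coordinate of the single point `τ` of `*(W × IPSet × PolyN)`.
    obtain ⟨τ, rfl, rfl, rfl⟩ : ∃ τ : N.Star (W × IPSet × PolyN), N.map (fun z => z.1) τ = ω ∧
        N.map (fun z => z.2.1) τ = x ∧ N.map (fun z => z.2.2) τ = P := by
      refine ⟨N.pair ω (N.pair x P), N.map_fst_pair _ _, ?_, ?_⟩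
      · rw [N.map_comp Prod.fst Prod.snd, map_snd_pair, map_fst_pair]
      · rw [N.map_comp Prod.snd Prod.snd, map_snd_pair, map_snd_pair]
    rw [← N.mem_ext_preimage] at hD
    simp only [← N.map_comp] at hx hP ⊢
    rw [map_mem_hyperfinite_map] at hx hP
    rw [shiftedValue_map, ← mem_ext_preimage]
    refine N.ext_mono ?_ (N.mem_ext_inter hD (N.mem_ext_inter hx hP))
    exact fun z hz => hz.1 _ hz.2.1 _ hz.2.2

theorem mem_JpUltrafilters_of_shiftedValue_mem_monad {p : Ultrafilter ℕ+} (η : N.Star ℕ+)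
    (β : N.Star NEFin)
    (h : ∀ (x : IPSet) (P : PolyN), N.shiftedValue η (N.of P) (N.of x) β ∈ N.monad p) :
    p ∈ JpUltrafilters := by
  intro A hA F l x
  obtain ⟨ω, rfl, rfl⟩ : ∃ ω : N.Star (ℕ+ × NEFin), N.map (fun w => w.1) ω = η ∧
      N.map (fun w => w.2) ω = β :=
    ⟨N.pair η β, N.map_fst_pair _ _, N.map_snd_pair _ _⟩
  obtain ⟨w, hw⟩ := N.nonempty_of_mem_ext <|
    N.mem_ext_setOf_forall_mem_finset (F ×ˢ (Finset.univ : Finset (Fin l)))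
      (fun k => (fun w : ℕ+ × NEFin => w.1 + k.1.app ((x k.2).at w.2)) ⁻¹' A) ω fun k _ => by
        rw [mem_ext_preimage, ← shiftedValue_map, map_const, map_const]
        exact h (x k.2) k.1 A hA
  refine ⟨w.1, w.2, fun P hP i => ⟨_, hw (P, i) (by simp [hP]), ?_⟩⟩
  simp

end NonstandardExtension

theorem mainTheorem12 (N : NonstandardExtension.{u})
    (hN : N.IsSaturated (Order.succ (Cardinal.lift.{u} (Cardinal.mk (Set ℕ+)))))
    (p : Ultrafilter ℕ+) :
    List.TFAE
      [p ∈ JpUltrafilters,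
        ∃ (η : N.Star ℕ+) (β : N.Star NEFin), ∀ (x : IPSet) (P : PolyN),
          N.shiftedValue η (N.of P) (N.of x) β ∈ N.monad p,
        ∃ (η : N.Star ℕ+) (β : N.Star NEFin)
          (I : N.Star (Finset IPSet)) (H : N.Star (Finset PolyN)),
          (∀ x : IPSet, N.of x ∈ N.hyperfinite I) ∧
          (∀ P : PolyN, N.of P ∈ N.hyperfinite H) ∧
          ∀ x ∈ N.hyperfinite I, ∀ P ∈ N.hyperfinite H,
            N.shiftedValue η P x β ∈ N.monad p] := by
  tfae_have 1 → 3 := N.exists_hyperfinite_of_mem_JpUltrafilters hN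
  tfae_have 3 → 2 := fun ⟨η, β, _, _, hI, hH, h⟩ => ⟨η, β, fun x P => h _ (hI x) _ (hH P)⟩
  tfae_have 2 → 1 := fun ⟨η, β, h⟩ => N.mem_JpUltrafilters_of_shiftedValue_mem_monad η β h
  tfae_finish
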